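/- A loop is a set $L$ with a binary operation having a two-sided identity element $1$ such that, for every $a \in L$, the left translation $L_a : x \mapsto ax$ and the right translation $R_a : x \mapsto xa$ are bijections of $L$. The multiplication group of $L$ is the group of permutations of $L$ generated by all $L_a$ and $R_a$ ($a \in L$), and an inner mapping of $L$ is an element of the multiplication group that fixes $1$. A loop is automorphic if each of its inner mappings is an automorphism of the loop. A half-isomorphism between loops $(L,*)$ and $(L',\cdot)$ is a bijection $f : L \to L'$ such that $f(x*y) \in \{f(x)\cdot f(y),\, f(y)\cdot f(x)\}$ for all $x,y \in L$. Theorem. Let $(Q,*)$ and $(Q',\cdot)$ be automorphic loops, and suppose that for all $x,y \in Q'$, $$x\cdot(x\cdot y) = (y\cdot x)\cdot x \quad\text{if and only if}\quad x\cdot y = y\cdot x.$$ Then every half-isomorphism $f : Q \to Q'$ is trivial, that is, $f$ is either an isomorphism ($f(x*y)=f(x)\cdot f(y)$ for all $x,y\in Q$) or an anti-isomorphism ($f(x*y)=f(y)\cdot f(x)$ for all $x,y\in Q$). -/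

import Mathlib

/-- A loop: a multiplicative system with a two-sided identity element `1` in which every
left translation `x ↦ a * x` and every right translation `x ↦ x * a` is a bijection.
Associativity is not required. -/
class Loop (L : Type*) extends MulOneClass L where
  left_bijective : ∀ a : L, Function.Bijective (fun x : L => a * x)
  right_bijective : ∀ a : L, Function.Bijective (fun x : L => x * a)

namespace Loop

/-- The left translation `x ↦ a * x`, as a permutation of the loop. -/
noncomputable def leftTranslation {L : Type*} [Loop L] (a : L) : Equiv.Perm L :=
  Equiv.ofBijective (fun x : L => a * x) (Loop.left_bijective a)

/-- The right translation `x ↦ x * a`, as a permutation of the loop. -/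
noncomputable def rightTranslation {L : Type*} [Loop L] (a : L) : Equiv.Perm L :=
  Equiv.ofBijective (fun x : L => x * a) (Loop.right_bijective a)

/-- The multiplication group: generated by all right and left translations. -/
def multiplicationGroup (L : Type*) [Loop L] : Subgroup (Equiv.Perm L) :=
  Subgroup.closure
    (Set.range (rightTranslation : L → Equiv.Perm L) ∪
      Set.range (leftTranslation : L → Equiv.Perm L))

/-- The inner mapping group: the elements of the multiplication group that fix the identity. -/
def innerMappingGroup (L : Type*) [Loop L] : Subgroup (Equiv.Perm L) :=
  multiplicationGroup L ⊓ MulAction.stabilizer (Equiv.Perm L) (1 : L)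

/-- An isomorphism of loops: a bijection with `f (x * y) = f x * f y`. -/
def IsIsomorphism {L L' : Type*} [Loop L] [Loop L'] (f : L → L') : Prop :=
  Function.Bijective f ∧ ∀ x y : L, f (x * y) = f x * f y

/-- An anti-isomorphism of loops: a bijection with `f (x * y) = f y * f x`. -/
def IsAntiIsomorphism {L L' : Type*} [Loop L] [Loop L'] (f : L → L') : Prop :=
  Function.Bijective f ∧ ∀ x y : L, f (x * y) = f y * f x

/-- A half-isomorphism of loops: a bijection such that, for each pair `x, y`, the element
`f (x * y)` is `f x * f y` or `f y * f x`. -/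
def IsHalfIsomorphism {L L' : Type*} [Loop L] [Loop L'] (f : L → L') : Prop :=
  Function.Bijective f ∧ ∀ x y : L, f (x * y) ∈ ({f x * f y, f y * f x} : Set L')

/-- An automorphic loop: every inner mapping is an automorphism of the loop. -/
def IsAutomorphic (L : Type*) [Loop L] : Prop :=
  ∀ φ ∈ innerMappingGroup L, IsIsomorphism (φ : L → L)

end Loop

/-! Write T_x for `conj x`. It is an automorphism, T_{x⁻¹} inverts it, and the hypothesis on Q' says
that T_x² fixes y only if T_x does. Call (x, y) positive if f(xy) = f(x)f(y), negative if f(xy) =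
f(y)f(x).

Commuting elements have commuting images: otherwise f would change orientation along some line c * u
^ k, which `not_bent` excludes. Hence (x, y) and (y, x) have the same sign, and f carries T_a b to
T_{f a}(f b) or to its T_{f a}⁻¹ analogue, according to the sign of (a, b). Comparing these on
b(cb), with (a, b) positive and (a, c) negative, shows that the noncommuting partners of a fixed a
all have one sign (`commute_of_mixed`). Noncommuting pairs of opposite sign are then linked through
a product of two of their entries. -/

namespace Loop

/-! ### Inner mappings, inverses and lines in automorphic loops -/

variable {L : Type*} [Loop L]

instance : IsLeftCancelMul L := ⟨fun a _ _ h => (Loop.left_bijective a).1 h⟩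

instance : IsRightCancelMul L := ⟨fun a _ _ h => (Loop.right_bijective a).1 h⟩

@[simp] theorem leftTranslation_apply (a x : L) : leftTranslation a x = a * x := rfl

@[simp] theorem rightTranslation_apply (a x : L) : rightTranslation a x = x * a := rfl

@[simp] theorem mul_leftTranslation_symm (a x : L) : a * (leftTranslation a).symm x = x :=
  (leftTranslation a).apply_symm_apply x

@[simp] theorem rightTranslation_symm_mul (a x : L) : (rightTranslation a).symm x * a = x :=
  (rightTranslation a).apply_symm_apply x

theorem leftTranslation_mem (a : L) : leftTranslation a ∈ multiplicationGroup L :=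
  Subgroup.subset_closure (Or.inr ⟨a, rfl⟩)

theorem rightTranslation_mem (a : L) : rightTranslation a ∈ multiplicationGroup L :=
  Subgroup.subset_closure (Or.inl ⟨a, rfl⟩)

/-- An element of the multiplication group of an automorphic loop that fixes `1`, as an
automorphism. -/
def innerEquiv (hL : IsAutomorphic L) (φ : Equiv.Perm L) (hφ : φ ∈ multiplicationGroup L)
    (h1 : φ 1 = 1) : L ≃* L :=
  { φ with map_mul' := (hL φ ⟨hφ, h1⟩).2 }

@[simp] theorem innerEquiv_apply (hL : IsAutomorphic L) (φ : Equiv.Perm L)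
    (hφ : φ ∈ multiplicationGroup L) (h1 : φ 1 = 1) (x : L) : innerEquiv hL φ hφ h1 x = φ x := rfl

/-- The middle inner mapping `y ↦ x \ (y * x)`. -/
noncomputable def conj (hL : IsAutomorphic L) (x : L) : L ≃* L :=
  innerEquiv hL ((leftTranslation x)⁻¹ * rightTranslation x)
    (mul_mem (inv_mem (leftTranslation_mem x)) (rightTranslation_mem x))
    (mul_left_cancel (a := x) (by simp))

variable (hL : IsAutomorphic L)

theorem mul_conj (x y : L) : x * conj hL x y = y * x := by
  simp [conj]

theorem conj_eq {x y z : L} (h : x * z = y * x) : conj hL x y = z :=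
  mul_left_cancel ((mul_conj hL x y).trans h.symm)

theorem conj_eq_self_iff {x y : L} : conj hL x y = y ↔ x * y = y * x :=
  ⟨fun h => by rw [← mul_conj hL x y, h], conj_eq hL⟩

theorem conj_self (x : L) : conj hL x x = x := conj_eq hL rfl

theorem conj_mul_left (x y : L) : conj hL x (x * y) = y * x := by
  rw [map_mul, conj_self, mul_conj]

include hL in
theorem flexible (x y : L) : x * (y * x) = (x * y) * x := by
  rw [← conj_mul_left hL x y, mul_conj]

/-- The inverse of an element of a loop (two-sided in the automorphic case). -/
noncomputable instance : Inv L := ⟨fun x => (leftTranslation x).symm 1⟩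

@[simp] theorem mul_inv_self (x : L) : x * x⁻¹ = 1 := mul_leftTranslation_symm x 1

theorem eq_inv_of_mul_eq_one {x y : L} (h : x * y = 1) : y = x⁻¹ :=
  mul_left_cancel (h.trans (mul_inv_self x).symm)

include hL in
theorem inv_mul_self (x : L) : x⁻¹ * x = 1 := by
  apply mul_left_cancel (a := x)
  rw [flexible hL, mul_inv_self, one_mul, mul_one]

include hL in
theorem inv_inv (x : L) : x⁻¹⁻¹ = x := (eq_inv_of_mul_eq_one (inv_mul_self hL x)).symm

theorem map_inv {L' : Type*} [Loop L'] (φ : L ≃* L') (x : L) : φ x⁻¹ = (φ x)⁻¹ :=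
  eq_inv_of_mul_eq_one (by rw [← map_mul, mul_inv_self, map_one])

include hL in
theorem exists_left (x y : L) :
    ∃ α : L ≃* L, α x = x ∧ ∀ z, (x * y) * α z = x * (y * z) := by
  have h : ∀ z, (x * y) * ((leftTranslation (x * y))⁻¹ * leftTranslation x * leftTranslation y) z
      = x * (y * z) := fun z => by simp
  refine ⟨innerEquiv hL ((leftTranslation (x * y))⁻¹ * leftTranslation x * leftTranslation y)
    (mul_mem (mul_mem (inv_mem (leftTranslation_mem _)) (leftTranslation_mem _))
      (leftTranslation_mem _)) (mul_left_cancel ((h 1).trans (by simp))), ?_, h⟩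
  exact mul_left_cancel ((h x).trans (flexible hL x y))

include hL in
theorem exists_middle (x y : L) :
    ∃ β : L ≃* L, β x = x ∧ ∀ z, β z * (x * y) = x * (z * y) := by
  have h : ∀ z, ((rightTranslation (x * y))⁻¹ * leftTranslation x * rightTranslation y) z * (x * y)
      = x * (z * y) := fun z => by simp
  refine ⟨innerEquiv hL ((rightTranslation (x * y))⁻¹ * leftTranslation x * rightTranslation y)
    (mul_mem (mul_mem (inv_mem (rightTranslation_mem _)) (leftTranslation_mem _))
      (rightTranslation_mem _)) (mul_right_cancel ((h 1).trans (by simp))), ?_, h⟩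
  exact mul_right_cancel (h x)

include hL in
/-- The antiautomorphic inverse property. -/
theorem mul_inv_rev (x y : L) : (x * y)⁻¹ = y⁻¹ * x⁻¹ := by
  have key : ∀ r z : L, (r * z⁻¹)⁻¹ = z * r⁻¹ := by
    intro r z
    obtain ⟨ζ, hx, hζ⟩ := exists_left hL (r * z⁻¹) z
    set w := (r * z⁻¹) * z with hw
    have h1 := hζ z⁻¹
    rw [mul_inv_self, mul_one] at h1
    -- ζ fixes r * z⁻¹, so this gives ζ r = w; evaluating hζ at r⁻¹ then exhibits z * r⁻¹ as an
    -- inverse.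
    have h2 : ζ.symm w * z⁻¹ = r * z⁻¹ := by
      apply ζ.injective
      rw [map_mul, ζ.apply_symm_apply, h1, hx]
    have h3 : ζ.symm w = r := mul_right_cancel h2
    have h4 := hζ (ζ.symm w⁻¹)
    rw [ζ.apply_symm_apply, mul_inv_self, map_inv, h3] at h4
    exact (eq_inv_of_mul_eq_one h4.symm).symm
  have := key x y⁻¹
  rwa [inv_inv hL] at this

include hL in
theorem exists_mul_inv (x : L) : ∃ μ : L ≃* L, μ x = x ∧ ∀ y, μ y = x * (x⁻¹ * y) := by
  refine ⟨innerEquiv hL (leftTranslation x * leftTranslation x⁻¹)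
    (mul_mem (leftTranslation_mem _) (leftTranslation_mem _)) (by simp), ?_, fun _ => rfl⟩
  simp [inv_mul_self hL]

include hL in
theorem inv_mul_mul (x y : L) : x⁻¹ * (x * y) = x * (x⁻¹ * y) := by
  obtain ⟨μ, hx, hμ⟩ := exists_mul_inv hL x
  have h := map_mul μ x y
  rw [hx, hμ, hμ] at h
  exact mul_left_cancel h

include hL in
theorem inv_mul_mul_right (x y : L) : x⁻¹ * (y * x) = (x⁻¹ * y) * x := by
  have h1 : (rightTranslation x * leftTranslation x⁻¹) 1 = 1 := by simp [inv_mul_self hL]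
  have h := map_mul (innerEquiv hL (rightTranslation x * leftTranslation x⁻¹)
    (mul_mem (rightTranslation_mem _) (leftTranslation_mem _)) h1) y x
  simp only [innerEquiv_apply, Equiv.Perm.mul_apply, leftTranslation_apply, rightTranslation_apply,
    inv_mul_self hL, one_mul] at h
  exact mul_right_cancel h

include hL in
theorem mul_inv_mul (x y : L) : (y * x⁻¹) * x = x * (x⁻¹ * y) := by
  obtain ⟨μ, -, hμ⟩ := exists_mul_inv hL x
  have h := map_inv μ y⁻¹
  rw [inv_inv hL, hμ, hμ, ← inv_mul_mul hL x y⁻¹, mul_inv_rev hL, mul_inv_rev hL, inv_inv hL,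
    inv_inv hL] at h
  exact h.symm

theorem conj_inv_conj (x y : L) : conj hL x⁻¹ (conj hL x y) = y := by
  apply conj_eq
  apply mul_left_cancel (a := x)
  have h := mul_conj hL x (y * x⁻¹)
  rw [map_mul, map_inv, conj_self, mul_inv_mul hL] at h
  exact h.symm

include hL in
theorem commute_mul {x y z : L} (hy : x * y = y * x) (hz : x * z = z * x) :
    x * (y * z) = (y * z) * x := by
  rw [← conj_eq_self_iff hL] at *
  rw [map_mul, hy, hz]

include hL in
theorem commute_inv {x y : L} (hy : x * y = y * x) : x * y⁻¹ = y⁻¹ * x := by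
  rw [← conj_eq_self_iff hL] at *
  rw [map_inv, hy]

include hL in
theorem commute_right {x y z : L} (hy : x * y = y * x) (hz : x * (y * z) = (y * z) * x) :
    x * z = z * x := by
  rw [← conj_eq_self_iff hL] at *
  rw [map_mul, hy] at hz
  exact mul_left_cancel hz

include hL in
theorem commute_left {x y z : L} (hy : x * y = y * x) (hz : x * (z * y) = (z * y) * x) :
    x * z = z * x := by
  rw [← conj_eq_self_iff hL] at *
  rw [map_mul, hy] at hz
  exact mul_right_cancel hz

include hL in
theorem mul_inv_inv (x : L) : x * (x⁻¹ * x⁻¹) = x⁻¹ := by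
  rw [← inv_mul_mul hL, mul_inv_self, mul_one]

include hL in
theorem mul_inv_inv_inv (x : L) : x * (x⁻¹ * (x⁻¹ * x⁻¹)) = x⁻¹ * x⁻¹ := by
  rw [← inv_mul_mul hL, mul_inv_inv hL]

include hL in
/-- The points `x * y ^ (k + 1)` of the line through `x` and `c = x * y` can be computed from
`c`: they are `c * v ^ k`, where `c * v⁻¹ = x`. -/
theorem line {x y c v : L} (hc : x * y = c) (hv : c * v⁻¹ = x) :
    x * (y * y) = c * v ∧ x * y⁻¹ = c * (v⁻¹ * v⁻¹) ∧
      x * (y⁻¹ * y⁻¹) = c * (v⁻¹ * (v⁻¹ * v⁻¹)) := by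
  -- α sends y to v, hence powers of y to powers of v.
  obtain ⟨α, hx, hα⟩ := exists_left hL x y
  rw [hc] at hα
  have h1 : α y = v := by
    have h := hα y⁻¹
    rw [mul_inv_self, mul_one, ← hv, map_inv] at h
    rw [← inv_inv hL (α y), mul_left_cancel h, inv_inv hL]
  refine ⟨?_, ?_, ?_⟩
  · rw [← hα, h1]
  · have h := hα (y⁻¹ * y⁻¹)
    rw [map_mul, map_inv, h1, mul_inv_inv hL] at h
    exact h.symm
  · have h := hα (y⁻¹ * (y⁻¹ * y⁻¹))
    rw [map_mul, map_mul, map_inv, h1, mul_inv_inv_inv hL] at h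
    exact h.symm

end Loop

namespace Loop

/-! ### Consequences of the hypothesis on T_x² -/

variable {L : Type*} [Loop L] (hL : IsAutomorphic L)

theorem conj_conj_inv (x y : L) : conj hL x (conj hL x⁻¹ y) = y := by
  have h := conj_inv_conj hL x⁻¹ y
  rwa [inv_inv hL] at h

theorem commute_of_conj_conj (hco : ∀ x y : L, x * (x * y) = (y * x) * x → x * y = y * x)
    {x y : L} (h : conj hL x (conj hL x y) = y) : x * y = y * x := by
  apply hco
  have h1 := mul_conj hL x y
  have h2 := mul_conj hL x (conj hL x y)
  rw [h] at h2
  rw [h2, flexible hL, h1]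

include hL in
/-- An element commuting with the square of `x` commutes with `x`. -/
theorem commute_of_commute_sq (hco : ∀ x y : L, x * (x * y) = (y * x) * x → x * y = y * x)
    {a x : L} (h : (x * x) * a = a * (x * x)) : x * a = a * x := by
  -- Both α and β fix a and pull x * x back to the same element. With P, R the preimages of a * x,
  -- this yields T_x P = R = T_x⁻¹ P, so x commutes with P and with a = P * x⁻¹.
  obtain ⟨α, ha, hα⟩ := exists_left hL a x
  obtain ⟨β, hb, hβ⟩ := exists_middle hL a x
  have hsx : (x * x) * x = x * (x * x) := (flexible hL x x).symm
  have hsd := commute_mul hL h hsx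
  have hse : (x * x) * α x = α x * (x * x) := by
    apply commute_right hL hsd
    rw [hα]
    exact commute_mul hL h rfl
  have hσ : α.symm (x * x) * x = x * α.symm (x * x) := by
    have := congrArg α.symm hse
    rwa [map_mul α.symm (x * x) _, map_mul α.symm _ (x * x), α.symm_apply_apply] at this
  have h1 := hα (α.symm (x * x))
  have h2 := hβ (β.symm (x * x))
  rw [α.apply_symm_apply] at h1
  rw [β.apply_symm_apply, hsd, h1] at h2
  have hσσ : β.symm (x * x) = α.symm (x * x) :=
    mul_right_cancel ((mul_left_cancel h2).symm.trans hσ.symm)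
  have ha' : α.symm a = a := by rw [α.symm_apply_eq, ha]
  have hb' : β.symm a = a := by rw [β.symm_apply_eq, hb]
  have a1 : α.symm (a * x) * x⁻¹ = a := by
    have := congrArg α.symm (hα x⁻¹)
    rwa [map_mul, α.symm_apply_apply, mul_inv_self, mul_one, ha'] at this
  have a2 : α.symm (a * x) * x = a * α.symm (x * x) := by
    have := congrArg α.symm (hα x)
    rwa [map_mul α.symm (a * x) _, α.symm_apply_apply, map_mul α.symm a (x * x), ha'] at this
  have b1 : x⁻¹ * β.symm (a * x) = a := by
    have := congrArg β.symm (hβ x⁻¹)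
    rwa [map_mul, β.symm_apply_apply, inv_mul_self hL, mul_one, hb'] at this
  have b2 : x * β.symm (a * x) = a * α.symm (x * x) := by
    have := congrArg β.symm (hβ x)
    rwa [map_mul β.symm _ (a * x), β.symm_apply_apply, map_mul β.symm a (x * x), hb', hσσ] at this
  have t1 : conj hL x (α.symm (a * x)) = β.symm (a * x) := conj_eq hL (b2.trans a2.symm)
  have t2 : conj hL x⁻¹ (α.symm (a * x)) = β.symm (a * x) := conj_eq hL (b1.trans a1.symm)
  have h3 : x * α.symm (a * x) = α.symm (a * x) * x := by
    apply commute_of_conj_conj hL hco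
    rw [t1, ← t2, conj_conj_inv]
  rw [← a1]
  exact commute_mul hL h3 (commute_inv hL rfl)

include hL in
-- Applying T_x to u⁻¹(cu) = (u⁻¹c)u forces T_x u = u.
theorem commute_of_conj_mul_swap {x u c : L} (hx : x = u⁻¹ * c) (h : x * (u * c) = (c * u) * x) :
    u * c = c * u := by
  have hT : conj hL x (c * u) = u * c := conj_eq hL h
  have h1 := congrArg (conj hL x) (inv_mul_mul_right hL u c)
  rw [map_mul, hT, ← hx, conj_mul_left, hx, ← inv_mul_mul hL, ← hx, map_inv] at h1
  have h2 : conj hL x u = u := by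
    rw [← inv_inv hL (conj hL x u), mul_right_cancel h1, inv_inv hL]
  rw [conj_eq_self_iff, hx] at h2
  exact commute_right hL (commute_inv hL rfl) h2.symm

theorem inv_mul_eq_mul_conj_inv (c u : L) : c * (conj hL c u)⁻¹ = u⁻¹ * c := by
  rw [← map_inv, mul_conj]

include hL in
/-- An automorphism fixing two consecutive points of a line fixes the next one. -/
theorem map_eq_self_of_line (V : L ≃* L) {c u : L} (h1 : V (c * u⁻¹) = c * u⁻¹)
    (h2 : V (c * (u⁻¹ * u⁻¹)) = c * (u⁻¹ * u⁻¹)) : V c = c := by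
  obtain ⟨p, hp⟩ := (Loop.left_bijective (c * u⁻¹)).2 c
  have hp' : (c * u⁻¹) * p⁻¹⁻¹ = c := by rw [inv_inv hL]; exact hp
  have h3 := (line hL rfl hp').1
  rw [h3, map_mul, h1] at h2
  have h4 : V p = p := by
    rw [← inv_inv hL (V p), ← map_inv, mul_left_cancel h2, inv_inv hL]
  rw [← hp, inv_inv hL] at hp'
  have := congrArg V hp
  rw [map_mul, h1, h4] at this
  exact this.symm.trans hp

end Loop

namespace Loop

/-! ### Half-isomorphisms along a line -/

variable {Q L : Type*} [Loop Q] [Loop L] (hQ : IsAutomorphic Q) (hL : IsAutomorphic L)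
  (hco : ∀ x y : L, x * (x * y) = (y * x) * x → x * y = y * x)
  {f : Q → L} (hf : ∀ x y, f (x * y) = f x * f y ∨ f (x * y) = f y * f x)

include hf

theorem half_mul_self (x : Q) : f (x * x) = f x * f x := (hf x x).elim id id

theorem half_one : f 1 = 1 := by
  have h := half_mul_self hf 1
  rw [one_mul] at h
  exact mul_left_cancel (h.symm.trans (mul_one _).symm)

include hL in
theorem half_inv (x : Q) : f x⁻¹ = (f x)⁻¹ := by
  rcases hf x x⁻¹ with h | h <;> rw [mul_inv_self, half_one hf] at h
  · exact eq_inv_of_mul_eq_one h.symm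
  · rw [eq_inv_of_mul_eq_one h.symm, inv_inv hL]

include hQ hL hco in
-- The element is also a⁻¹(ab). If both expansions were reversed, T_{f a} and its inverse would
-- agree on f(a)(f(a)⁻¹f(b)).
theorem half_mul_inv_mul {a b : Q} (h1 : f (a * b) = f a * f b)
    (h2 : f (a⁻¹ * b) = (f a)⁻¹ * f b) :
    f (a * (a⁻¹ * b)) = f a * ((f a)⁻¹ * f b) := by
  rcases hf a (a⁻¹ * b) with h3 | h3
  · rw [h3, h2]
  rcases hf a⁻¹ (a * b) with h4 | h4
  · rw [← inv_mul_mul hQ, h4, h1, half_inv hL hf, inv_mul_mul hL]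
  rw [h2] at h3
  rw [inv_mul_mul hQ, h1, half_inv hL hf, h3] at h4
  have e1 := conj_mul_left hL (f a) ((f a)⁻¹ * f b)
  have e2 := conj_mul_left hL (f a)⁻¹ (f a * f b)
  rw [← h4, inv_mul_mul hL] at e2
  have e3 := commute_of_conj_conj hL hco (x := f a) (y := f a * ((f a)⁻¹ * f b))
    (by rw [e1, ← e2, conj_conj_inv])
  rw [h3, ← e1, conj_eq_self_iff]
  exact e3

include hQ hL hco in
/-- A half-isomorphism cannot reverse orientation along the line `c * u⁻¹, c, c * u` of commuting
elements whose images do not commute. -/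
theorem not_bent {c u : Q} (hcu : c * u = u * c) (hne : f c * f u ≠ f u * f c)
    (h1 : f (c * u) = f c * f u) (h2 : f (c * u⁻¹) = f u⁻¹ * f c) : False := by
  rw [half_inv hL hf] at h2
  obtain ⟨y, hy⟩ := (Loop.left_bijective (c * u⁻¹)).2 c
  change (c * u⁻¹) * y = c at hy
  obtain ⟨x, hx⟩ : ∃ x, x = c * u⁻¹ := ⟨_, rfl⟩
  rw [← hx] at h2 hy
  have lineQ := line hQ hy hx.symm
  have hxc : x * c = c * x := by
    rw [hx]
    exact (commute_mul hQ rfl (commute_inv hQ hcu)).symm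
  have hxy : x * y = y * x := commute_right hQ rfl (by rw [hy, hxc])
  have hXC : f x * f c ≠ f c * f x := by
    intro h
    rw [h2] at h
    exact hne (commute_inv hL (commute_left hL rfl h.symm) |> fun h' => by rwa [inv_inv hL] at h')
  have hX1 : (f x)⁻¹ = (f c)⁻¹ * f u := by rw [h2, mul_inv_rev hL, inv_inv hL]
  have hx1 : x⁻¹ = c⁻¹ * u := by
    rw [hx, mul_inv_rev hQ, inv_inv hQ]
    exact commute_inv hQ hcu.symm
  have hcx : f (c * x⁻¹) = f c * (f x)⁻¹ := by
    have := half_mul_inv_mul hQ hL hco hf h1 (by rw [← hx1, half_inv hL hf, hX1])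
    rwa [← hx1, ← hX1] at this
  have hv : f c * (conj hL (f c) (f u))⁻¹ = f x := by rw [inv_mul_eq_mul_conj_inv, h2]
  -- Next, y is the step from x to c; fixing its orientation here and in `hxy'` shows that c * u⁻²
  -- is reversed as well as c * u⁻¹.
  have hXY : f x * f y = f c := by
    rcases hf x y with h | h
    · rw [← h, hy]
    exfalso
    rw [hy] at h
    have hY : f x * conj hL (f x) (f y) = f c := by rw [mul_conj, h]
    have h3 := (line hL hY hv).1
    rw [← map_mul, mul_conj, mul_conj] at h3
    have h4 := hf x (y * y)
    rw [lineQ.1, h1, half_mul_self hf, h3] at h4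
    have h5 : f c * f u = f x * (f y * f y) := h4.resolve_right hne
    refine hne (commute_of_conj_mul_swap hL h2 ?_).symm
    rw [← h3, ← conj_mul_left hL (f x), ← h5, mul_conj]
  have hxy' : f (x * y⁻¹) = f x * (f y)⁻¹ := by
    rcases hf x y⁻¹ with h | h
    · rw [h, half_inv hL hf]
    exfalso
    have h3 : f (x⁻¹ * y) = (f x)⁻¹ * f y := by
      have : x⁻¹ * y = (x * y⁻¹)⁻¹ := by
        rw [mul_inv_rev hQ, inv_inv hQ]
        exact (commute_inv hQ hxy.symm).symm
      rw [this, half_inv hL hf, h, half_inv hL hf, mul_inv_rev hL, inv_inv hL]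
    have h4 := half_mul_inv_mul hQ hL hco hf (by rw [hy, hXY]) h3
    rw [← inv_mul_mul hQ, ← inv_mul_mul hL, hy, hXY] at h4
    have h5 : x⁻¹ * c = c * x⁻¹ := (commute_inv hQ hxc.symm).symm
    rw [h5, hcx] at h4
    have h6 := commute_inv hL h4
    rw [inv_inv hL] at h6
    exact hXC h6.symm
  have h3 : f (x * y⁻¹) = ((f u)⁻¹ * (f u)⁻¹) * f c := by
    rw [hxy', (line hL hXY hv).2.1, ← map_inv, ← map_mul, mul_conj]
  rw [lineQ.2.1] at h3
  have hne1 : f c * (f u)⁻¹ ≠ f x := by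
    intro h
    rw [h2] at h
    have := commute_inv hL h
    rw [inv_inv hL] at this
    exact hne this
  have hne2 : f c * ((f u)⁻¹ * (f u)⁻¹) ≠ f (c * (u⁻¹ * u⁻¹)) := by
    intro h
    rw [h3] at h
    have := commute_inv hL (commute_of_commute_sq hL hco h.symm).symm
    rw [inv_inv hL] at this
    exact hne this
  have hC1 : conj hL (f c) (f c * (f u)⁻¹) = f x := by rw [conj_mul_left, h2]
  have hC2 : conj hL (f c) (f c * ((f u)⁻¹ * (f u)⁻¹)) = f (c * (u⁻¹ * u⁻¹)) := by
    rw [conj_mul_left, h3]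
  have hfin : conj hL (f c * f u) (f c) ≠ f c := by
    intro h
    rw [conj_eq_self_iff] at h
    exact hne (commute_right hL rfl h.symm)
  -- The same line seen from c * u. On the images of c * u⁻¹ and c * u⁻², T_{f c} now agrees with
  -- T_{f c * f u} or its inverse, so they agree at f c too, which T_{f c} fixes.
  obtain ⟨p, hp⟩ := (Loop.left_bijective (c * u)).2 c
  change (c * u) * p = c at hp
  have lineW := line hQ rfl (v := p⁻¹) (by rw [inv_inv hQ, hp])
  simp only [inv_inv hQ] at lineW
  have hppp : f (p * (p * p)) = f p * (f p * f p) := by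
    rcases hf p (p * p) with h | h
    · rw [h, half_mul_self hf]
    · rw [h, half_mul_self hf, flexible hL]
  have g1 := hf (c * u) (p * p)
  have g2 := hf (c * u) (p * (p * p))
  rw [← lineW.2.1, ← hx, half_mul_self hf, h1] at g1
  rw [← lineW.2.2, hppp, h1] at g2
  have hW := hf (c * u) p
  rw [hp, h1] at hW
  rcases hW with hW | hW
  · have lineL := line hL rfl (v := (f p)⁻¹) (by rw [inv_inv hL, hW.symm])
    simp only [inv_inv hL] at lineL
    rw [← lineL.2.1, ← conj_mul_left hL (f c * f u), ← lineL.2.1] at g1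
    rw [← lineL.2.2, ← conj_mul_left hL (f c * f u), ← lineL.2.2] at g2
    have k := map_eq_self_of_line hL ((conj hL (f c)).trans (conj hL (f c * f u)).symm)
      (c := f c) (u := f u)
      (by rw [MulEquiv.trans_apply, hC1, MulEquiv.symm_apply_eq]
          exact g1.resolve_left hne1.symm)
      (by rw [MulEquiv.trans_apply, hC2, MulEquiv.symm_apply_eq]
          exact g2.resolve_left hne2.symm)
    rw [MulEquiv.trans_apply, conj_self, MulEquiv.symm_apply_eq] at k
    exact hfin k.symm
  · rw [← mul_conj hL] at hW
    have lineL := line hL rfl (v := (conj hL (f c * f u) (f p))⁻¹) (by rw [inv_inv hL, ← hW])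
    simp only [inv_inv hL, ← map_mul, mul_conj] at lineL
    rw [← lineL.2.1] at g1
    rw [← lineL.2.2] at g2
    have k := map_eq_self_of_line hL ((conj hL (f c)).trans (conj hL (f c * f u)))
      (c := f c) (u := f u)
      (by rw [MulEquiv.trans_apply, hC1, g1.resolve_right hne1.symm, conj_mul_left, lineL.2.1])
      (by rw [MulEquiv.trans_apply, hC2, g2.resolve_right hne2.symm, conj_mul_left, lineL.2.2])
    rw [MulEquiv.trans_apply, conj_self] at k
    exact hfin k

end Loop

namespace Loop

/-- If `z ↦ x * (z * x)` and `z ↦ y * (z * y)` agree at `e` and `e * e`, they agree at `1`. -/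
theorem mul_self_eq_of_triple_eq {L : Type*} [Loop L] (hL : IsAutomorphic L) {e x y : L}
    (h1 : x * (e * x) = y * (e * y)) (h2 : x * ((e * e) * x) = y * ((e * e) * y)) :
    x * x = y * y := by
  have hmem : ∀ z : L, leftTranslation z * rightTranslation z ∈ multiplicationGroup L :=
    fun z => mul_mem (leftTranslation_mem z) (rightTranslation_mem z)
  set Φ : Equiv.Perm L := (leftTranslation y * rightTranslation y)⁻¹ *
    (leftTranslation x * rightTranslation x)
  have key : ∀ z, y * (Φ z * y) = x * (z * x) := fun z =>
    (leftTranslation y * rightTranslation y).apply_symm_apply (x * (z * x))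
  have hfix : ∀ z, x * (z * x) = y * (z * y) → Φ z = z := fun z hz =>
    mul_right_cancel (mul_left_cancel ((key z).trans hz))
  -- As Φ fixes e, its conjugate by L_e is inner. It fixes e, hence e⁻¹, so Φ fixes 1.
  obtain ⟨φ, hφ⟩ : ∃ φ : L ≃* L, ∀ z, e * φ z = Φ (e * z) := by
    have h : ∀ z, e * ((leftTranslation e)⁻¹ * Φ * leftTranslation e) z = Φ (e * z) :=
      fun z => mul_leftTranslation_symm e _
    exact ⟨innerEquiv hL ((leftTranslation e)⁻¹ * Φ * leftTranslation e)
      (mul_mem (mul_mem (inv_mem (leftTranslation_mem e)) (mul_mem (inv_mem (hmem y)) (hmem x)))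
        (leftTranslation_mem e))
      (mul_left_cancel ((h 1).trans (by rw [mul_one, hfix e h1]))), h⟩
  have he : φ e = e := mul_left_cancel ((hφ e).trans (hfix _ h2))
  have h3 : Φ 1 = 1 := by
    have h := hφ e⁻¹
    rw [mul_inv_self, map_inv, he, mul_inv_self] at h
    exact h.symm
  have h4 := key 1
  rw [h3, one_mul, one_mul] at h4
  exact h4.symm

variable {Q L : Type*} [Loop Q] [Loop L] (hQ : IsAutomorphic Q) (hL : IsAutomorphic L)
  (hco : ∀ x y : L, x * (x * y) = (y * x) * x → x * y = y * x)
  {f : Q → L} (hf : ∀ x y, f (x * y) = f x * f y ∨ f (x * y) = f y * f x)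

include hQ hL hco hf

theorem half_commute {x y : Q} (h : x * y = y * x) : f x * f y = f y * f x := by
  by_contra hne
  have hne' : f x * (f y)⁻¹ ≠ (f y)⁻¹ * f x := fun h' => by
    have := commute_inv hL h'
    rw [inv_inv hL] at this
    exact hne this
  have hne'' : f y * (f x)⁻¹ ≠ (f x)⁻¹ * f y := fun h' => by
    have := commute_inv hL h'
    rw [inv_inv hL] at this
    exact hne this.symm
  have hyx : f (y * x⁻¹) = (f (x * y⁻¹))⁻¹ := by
    rw [← half_inv hL hf, mul_inv_rev hQ, inv_inv hQ]
  -- If the line through x is straight, the line through y is bent, since xy = yx is read with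
  -- opposite orientation there.
  rcases hf x y with h1 | h1 <;> rcases hf x y⁻¹ with h2 | h2 <;> rw [half_inv hL hf] at h2
  · rw [h2, mul_inv_rev hL, inv_inv hL] at hyx
    exact not_bent hQ hL hco hf (c := y) (u := x⁻¹) (commute_inv hQ h.symm)
      (by rwa [half_inv hL hf]) (by rw [hyx, half_inv hL hf])
      (by rw [inv_inv hQ, ← h, h1])
  · exact not_bent hQ hL hco hf h hne h1 (by rw [h2, half_inv hL hf])
  · exact not_bent hQ hL hco hf (c := x) (u := y⁻¹) (commute_inv hQ h)
      (by rwa [half_inv hL hf]) (by rw [h2, half_inv hL hf]) (by rw [inv_inv hQ, h1])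
  · rw [h2, mul_inv_rev hL, inv_inv hL] at hyx
    exact not_bent hQ hL hco hf h.symm (Ne.symm hne) (by rw [← h, h1])
      (by rw [hyx, half_inv hL hf])

/-! ### All noncommuting pairs have one orientation -/

variable (hinj : Function.Injective f)

include hinj

theorem half_commute_iff {x y : Q} : f x * f y = f y * f x ↔ x * y = y * x := by
  refine ⟨fun h => hinj ?_, half_commute hQ hL hco hf⟩
  rw [(hf x y).elim id (fun h' => h'.trans h.symm), (hf y x).elim (fun h' => h'.trans h.symm) id]

theorem half_mul_swap {x y : Q} (h : f (x * y) = f x * f y) : f (y * x) = f y * f x := by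
  rcases hf y x with h' | h'
  · exact h'
  · rw [h', half_commute hQ hL hco hf (hinj (h.trans h'.symm))]

theorem half_mul_swap_rev {x y : Q} (h : f (x * y) = f y * f x) : f (y * x) = f x * f y := by
  rcases hf y x with h' | h'
  · rw [h', half_commute hQ hL hco hf (hinj (h.trans h'.symm))]
  · exact h'

/-- Expand both x(yx) and (xy)x; the only other common value makes f x and f y commute by `hco`. -/
theorem half_triple (x y : Q) : f (x * (y * x)) = f x * (f y * f x) := by
  have h1 := hf x (y * x)
  have h2 := hf (x * y) x
  rw [← flexible hQ] at h2
  rcases hf x y with h | h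
  · rw [half_mul_swap hQ hL hco hf hinj h] at h1
    rw [h, ← flexible hL] at h2
    rcases h1 with h1 | h1
    · exact h1
    rcases h2 with h2 | h2
    · exact h2
    rw [h1, flexible hL, hco _ _ (h2.symm.trans h1)]
  · rw [half_mul_swap_rev hQ hL hco hf hinj h] at h1
    rw [h] at h2
    rcases h2 with h2 | h2
    · rcases h1 with h1 | h1
      · rw [h2, flexible hL, hco _ _ (h1.symm.trans h2)]
      · rw [h1, flexible hL]
    · exact h2

theorem half_conj {x y : Q} (h : f (x * y) = f x * f y) :
    f (conj hQ x y) = conj hL (f x) (f y) := by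
  have h1 := half_mul_swap hQ hL hco hf hinj h
  rw [← mul_conj hQ] at h1
  rcases hf x (conj hQ x y) with h2 | h2
  · exact (conj_eq hL (h2.symm.trans h1)).symm
  · have h3 := hinj (mul_right_cancel (h2.symm.trans h1))
    rw [h3, eq_comm, conj_eq_self_iff]
    exact half_commute hQ hL hco hf ((conj_eq_self_iff hQ).1 h3)

theorem half_conj_rev {x y : Q} (h : f (x * y) = f y * f x) :
    conj hL (f x) (f (conj hQ x y)) = f y := by
  have h1 := half_mul_swap_rev hQ hL hco hf hinj h
  rw [← mul_conj hQ] at h1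
  rcases hf x (conj hQ x y) with h2 | h2
  · have h3 := hinj (mul_left_cancel (h2.symm.trans h1))
    rw [h3, conj_eq_self_iff]
    exact half_commute hQ hL hco hf ((conj_eq_self_iff hQ).1 h3)
  · exact conj_eq hL (h1.symm.trans h2)

/-- The pair (a, b(cb)) must be negative: if positive, T_{f a} and its inverse would agree on f c.
-/
theorem half_triple_conj {a b c : Q} (hab : f (a * b) = f a * f b) (hac : f (a * c) = f c * f a)
    (hne : a * c ≠ c * a) :
    f (conj hQ a b) * (f (conj hQ a c) * f (conj hQ a b)) =
      (conj hL (f a)).symm (f b) * (f (conj hQ a c) * (conj hL (f a)).symm (f b)) := by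
  have h1 := half_conj hQ hL hco hf hinj hab
  have h2 := half_conj_rev hQ hL hco hf hinj hac
  have h3 := half_triple hQ hL hco hf hinj b c
  have h4 := half_triple hQ hL hco hf hinj (conj hQ a b) (conj hQ a c)
  rw [← map_mul, ← map_mul] at h4
  rw [← h4]
  rcases hf a (b * (c * b)) with h | h
  · exfalso
    have h5 := half_conj hQ hL hco hf hinj h
    rw [h4, h3, map_mul, map_mul, h1] at h5
    have h6 := mul_right_cancel (mul_left_cancel h5)
    rw [h6] at h2
    exact hne ((half_commute_iff hQ hL hco hf hinj).1 (commute_of_conj_conj hL hco h2))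
  · apply (conj hL (f a)).injective
    rw [half_conj_rev hQ hL hco hf hinj h, map_mul, map_mul, MulEquiv.apply_symm_apply, h2, h3]

/-- All pairs `(a, x)` of noncommuting elements have the same orientation under `f`. -/
theorem commute_of_mixed {a b c : Q} (hab : f (a * b) = f a * f b)
    (hac : f (a * c) = f c * f a) (hne : a * c ≠ c * a) : a * b = b * a := by
  have h2 := half_conj_rev hQ hL hco hf hinj hac
  have hsq := half_mul_self hf (conj hQ a c)
  rw [← map_mul] at hsq
  have hne' : a * (c * c) ≠ (c * c) * a := by
    intro h
    rw [← half_commute_iff hQ hL hco hf hinj, half_mul_self hf] at h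
    exact hne ((half_commute_iff hQ hL hco hf hinj).1
      (commute_of_commute_sq hL hco h.symm).symm)
  have hac' : f (a * (c * c)) = f (c * c) * f a := by
    refine (hf a (c * c)).resolve_left fun h => hne' ?_
    have h3 := half_conj hQ hL hco hf hinj h
    rw [hsq] at h3
    rw [← half_commute_iff hQ hL hco hf hinj]
    apply commute_of_conj_conj hL hco
    rw [← h3, map_mul, h2, half_mul_self hf]
  -- Using c and c² gives agreement at e and e², hence T_{f a} and its inverse agree on (f b)².
  have h3 := half_triple_conj hQ hL hco hf hinj hab hac hne
  have h4 := half_triple_conj hQ hL hco hf hinj hab hac' hne'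
  rw [hsq] at h4
  have h5 := mul_self_eq_of_triple_eq hL h3 h4
  rw [half_conj hQ hL hco hf hinj hab, ← map_mul, ← map_mul] at h5
  have h6 := commute_of_conj_conj hL hco
    (by rw [h5, MulEquiv.apply_symm_apply] : conj hL (f a) (conj hL (f a) (f b * f b)) = _)
  rw [← half_commute_iff hQ hL hco hf hinj]
  exact (commute_of_commute_sq hL hco h6.symm).symm

theorem half_trivial :
    (∀ x y, f (x * y) = f x * f y) ∨ (∀ x y, f (x * y) = f y * f x) := by
  by_contra hcon
  push Not at hcon
  obtain ⟨⟨a', b', h'⟩, ⟨a, b, h⟩⟩ := hcon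
  have mixed : ∀ {a b c : Q}, f (a * b) = f a * f b → f (a * c) = f c * f a →
      a * c ≠ c * a → a * b = b * a := commute_of_mixed hQ hL hco hf hinj
  have swap : ∀ {x y : Q}, f (x * y) = f x * f y → f (y * x) = f y * f x :=
    half_mul_swap hQ hL hco hf hinj
  have swap' : ∀ {x y : Q}, f (x * y) = f y * f x → f (y * x) = f x * f y :=
    half_mul_swap_rev hQ hL hco hf hinj
  have hp := (hf a b).resolve_right h
  have hm := (hf a' b').resolve_left h'
  have hnp : a * b ≠ b * a := fun hc => h (hp.trans (half_commute hQ hL hco hf hc))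
  have hnm : a' * b' ≠ b' * a' := fun hc => h' (hm.trans (half_commute hQ hL hco hf hc.symm))
  have comm : ∀ {x y z w : Q}, f (x * y) = f x * f y → x * y ≠ y * x → f (z * w) = f w * f z →
      z * w ≠ w * z → x * z = z * x := by
    intro x y z w hxy nxy hzw nzw
    by_contra hxz
    rcases hf x z with hc | hc
    · exact hxz (mixed (swap hc) hzw nzw).symm
    · exact nxy (mixed hxy hc hxz)
  -- By these relations a * a' commutes with neither b nor b', so its signs with them would have to
  -- differ.
  have c1 : b * a' = a' * b := comm (swap hp) hnp.symm hm hnm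
  have c2 : a * b' = b' * a := comm hp hnp (swap' hm) hnm.symm
  have n1 : b * (a * a') ≠ (a * a') * b := fun hc => hnp (commute_left hQ c1 hc).symm
  have n2 : b' * (a * a') ≠ (a * a') * b' := fun hc => hnm (commute_right hQ c2.symm hc).symm
  rcases hf (a * a') b with hc | hc
  · rcases hf (a * a') b' with hd | hd
    · exact n2 (mixed (swap hd) (swap' hm) hnm.symm)
    · exact n1 (mixed hc hd n2.symm).symm
  · exact hnp (mixed (swap hp) (swap' hc) n1).symm

end Loop

theorem theorem4p1 {Q : Type*} {Q' : Type*} [Loop Q] [Loop Q']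
    (hQ : Loop.IsAutomorphic Q) (hQ' : Loop.IsAutomorphic Q')
    (hco : ∀ x y : Q', x * (x * y) = (y * x) * x ↔ x * y = y * x)
    (f : Q → Q') (hf : Loop.IsHalfIsomorphism f) :
    Loop.IsIsomorphism f ∨ Loop.IsAntiIsomorphism f :=
  (Loop.half_trivial hQ hQ' (fun x y => (hco x y).1) hf.2 hf.1.1).imp
    (fun h => ⟨hf.1, h⟩) (fun h => ⟨hf.1, h⟩)
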